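/- Let $(m_k)_{k\ge 0}$ be a sequence of natural numbers and, for each $k$, let $\mu_k$ be a Borel probability measure on $\mathbb R^{m_k}$ which is convex (log-concave), i.e. $\mu_k(tA+(1-t)B)\ge \mu_k(A)^t\mu_k(B)^{1-t}$ for all Borel sets $A,B$ and all $t\in(0,1)$. Let $\mu=\bigotimes_{k\ge0}\mu_k$ be the product measure on $\mathbb R^\infty=\prod_{k\ge 0}\mathbb R^{m_k}$, equipped with the product topology. Suppose that for some index $q$ the affine hull of the support of $\mu_q$ does not contain $0$. Let $f:\mathbb R^\infty\to\mathbb R$ be a linear functional that is $\mu$-measurable (measurable with respect to the $\mu$-completion of the Borel $\sigma$-algebra). Then $f$ is $\mu$-integrable and is the $\mu$-a.e. limit of a sequence of continuous linear functionals $g_n$ on $\mathbb R^\infty$. More precisely, let $\mathfrak B_n$ be the $\sigma$-algebra generated by the first $n$ factors, that is, by the coordinates $x_0,\dots,x_{n-1}$ with $x_k\in\mathbb R^{m_k}$, and put $$(E_nf)(x)=\int f(x_0,\dots,x_{n-1},y_n,y_{n+1},\dots)\,\Bigl(\bigotimes_{k\ge n}\mu_k\Bigr)(dy).$$ There are continuous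 linear functionals $g_n$ and continuous affine functions $\varphi_n$ on $\mathbb R^\infty$ such that $g_n(x)\to f(x)$ for $\mu$-a.e. $x$ and, for every $n>q$: 1. the integral defining $(E_nf)(x)$ converges absolutely for every $x\in\mathbb R^\infty$, and $E_nf$ is a version of the conditional expectation $\mathbb E^{\mathfrak B_n}_\mu f$; 2. $\varphi_n$ depends only on $x_0,\dots,x_{n-1}$, and $\varphi_n(x)=0$ whenever $x_k\in\operatorname{supp}\mu_k$ for all $k<n$; 3. $g_n$ depends only on $x_0,\dots,x_{n-1}$, and $g_n(x)=(E_nf)(x)+\varphi_n(x)$ for every $x\in\mathbb R^\infty$. -/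

import Mathlib

open MeasureTheory Filter Topology

open scoped Pointwise ENNReal

/-- The space `ℝ^∞`, written as the countable product of the spaces `ℝ^{m k}`, with the product
topology and the product (equivalently, Borel) sigma-algebra. -/
abbrev RInfty (m : ℕ → ℕ) : Type :=
  (k : ℕ) → EuclideanSpace ℝ (Fin (m k))

/-- A convex (logarithmically concave) measure:
`μ (t A + (1 - t) B) ≥ μ(A) ^ t * μ(B) ^ (1 - t)` for all measurable `A`, `B` and all `t`.
The endpoints `t = 0, 1` are omitted: they carry no information for nonempty `A`, `B`, and for an
empty set they would involve the expression `0 ^ 0`.  The set `t A + (1 - t) B` is analytic for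
Borel `A`, `B`, so the outer measure used by Lean is the value of the completed measure. -/
def IsConvexMeasure {X : Type*} [AddCommGroup X] [Module ℝ X] [MeasurableSpace X]
    (μ : Measure X) : Prop :=
  ∀ A B : Set X, MeasurableSet A → MeasurableSet B → ∀ t : ℝ, 0 < t → t < 1 →
    μ A ^ t * μ B ^ (1 - t) ≤ μ (t • A + (1 - t) • B)

/-- The point `(x_0, …, x_{n-1}, y_n, y_{n+1}, …)`. -/
def splice {m : ℕ → ℕ} (n : ℕ) (x y : RInfty m) : RInfty m :=
  fun k => if k < n then x k else y k

/-- The function `x ↦ ∫ f(x_0, …, x_{n-1}, y_n, y_{n+1}, …) (⨂_{k ≥ n} μ_k)(dy)`.  The integrand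
does not depend on `y_0, …, y_{n-1}`, and the factors are probability measures, so one may
integrate over the whole product measure. -/
noncomputable def tailAverage {m : ℕ → ℕ} (μ : Measure (RInfty m)) (f : RInfty m → ℝ) (n : ℕ)
    (x : RInfty m) : ℝ :=
  ∫ y, f (splice n x y) ∂μ

/-! By linearity `f (splice n x y) = h_n(x) + (f(y) - h_n(y))`, where the head functional `h_n` is
`f` restricted to the first `n` factors and is continuous because these are finite-dimensional. Once
`f` is integrable, its tail average is therefore `h_n + c_n` with `c_n = ∫ (f - h_n)`, and Lévy's
upward theorem gives convergence to `f` almost everywhere. The constant `c_n` is not linear. The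
hypothesis on `q` supplies a linear functional `l` of `x_q` equal to `1` on the support of `μ_q`, so
`g_n = h_n + c_n l` and `φ_n = c_n (l - 1)`.

The substance is integrability (`integrable_linear_of_isConvexMeasure`). Applying the martingale
theorem to a bounded truncation of `f - c` approximates `f` in probability by affine functions `U =
h_n + b` (`exists_headFunctional_approx`). Borell's tail bound on each factor gives `E X^4 ≤ C (E
X^2)^2`, and independence carries this to `U` with a constant free of `n` and `b`. By Paley–Zygmund
a quantile of `U`, hence one of `f`, bounds `E U^2`, and thus `E min(|f|, N)` uniformly in `N`.
Convexity is used one factor at a time, so its stability under products is not needed. -/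

/-! ### Tail averages, conditional expectation and martingale convergence -/

section Splice

variable {m : ℕ → ℕ}

lemma splice_of_lt {n k : ℕ} (hk : k < n) (x y : RInfty m) : splice n x y k = x k := if_pos hk

lemma splice_of_le {n k : ℕ} (hk : n ≤ k) (x y : RInfty m) : splice n x y k = y k :=
  if_neg (not_lt.2 hk)

lemma splice_self (n : ℕ) (x : RInfty m) : splice n x x = x := by
  funext k; simp [splice]

lemma splice_eq_add (n : ℕ) (x y : RInfty m) : splice n x y = splice n x 0 + splice n 0 y := by
  funext k
  by_cases hk : k < n <;> simp [splice, hk]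

lemma splice_splice_left (n : ℕ) (x y z : RInfty m) : splice n (splice n x y) z = splice n x z := by
  funext k
  by_cases hk : k < n <;> simp [splice, hk]

lemma measurable_splice (n : ℕ) :
    Measurable fun p : RInfty m × RInfty m => splice n p.1 p.2 := by
  refine measurable_pi_lambda _ fun k => ?_
  by_cases hk : k < n
  · simp only [splice, if_pos hk]
    fun_prop
  · simp only [splice, if_neg hk]
    fun_prop

lemma measurable_splice_cylinderEvents (n : ℕ) (y : RInfty m) :
    Measurable[cylinderEvents (Set.Iio n)] fun x : RInfty m => splice n x y := by
  rw [@measurable_pi_iff]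
  intro k
  by_cases hk : k < n
  · simpa only [splice, if_pos hk] using measurable_cylinderEvent_apply (Set.mem_Iio.2 hk)
  · simp only [splice, if_neg hk]
    exact @measurable_const _ _ _ (cylinderEvents (Set.Iio n)) _

/-- Every such event is a preimage under `x ↦ splice n x 0`, which forgets the tail. -/
lemma mem_splice_iff_of_measurableSet_cylinderEvents {n : ℕ} {A : Set (RInfty m)}
    (hA : MeasurableSet[cylinderEvents (Set.Iio n)] A) (x y : RInfty m) :
    splice n x y ∈ A ↔ x ∈ A := by
  have hle : (cylinderEvents (Set.Iio n) : MeasurableSpace (RInfty m)) ≤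
      MeasurableSpace.comap (fun x : RInfty m => splice n x 0)
        (cylinderEvents (Set.Iio n)) := by
    refine iSup₂_le fun k hk => ?_
    rintro s ⟨t, ht, rfl⟩
    refine ⟨(fun σ : RInfty m => σ k) ⁻¹' t, measurable_cylinderEvent_apply hk ht, ?_⟩
    ext x
    simp [splice, Set.mem_Iio.1 hk]
  obtain ⟨B, -, rfl⟩ := hle A hA
  simp only [Set.mem_preimage, splice_splice_left]

variable (μ : (k : ℕ) → Measure (EuclideanSpace ℝ (Fin (m k)))) [∀ k, IsProbabilityMeasure (μ k)]

/-- Replacing the tail of a sample by that of an independent copy preserves a product measure. -/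
lemma measurePreserving_splice (n : ℕ) :
    MeasurePreserving (fun p : RInfty m × RInfty m => splice n p.1 p.2)
      ((Measure.infinitePi μ).prod (Measure.infinitePi μ)) (Measure.infinitePi μ) := by
  refine ⟨measurable_splice n, Measure.eq_infinitePi μ fun s t ht => ?_⟩
  have hpre : (fun p : RInfty m × RInfty m => splice n p.1 p.2) ⁻¹' (Set.pi s t) =
      (Set.pi (s.filter (· < n)) t) ×ˢ (Set.pi (s.filter fun k => ¬ k < n) t) := by
    ext p
    simp only [Set.mem_preimage, Set.mem_pi, Set.mem_prod, Finset.coe_filter, Set.mem_ofPred_eq,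
      Finset.mem_coe]
    constructor
    · intro h
      refine ⟨fun k hk => ?_, fun k hk => ?_⟩
      · simpa [splice, hk.2] using h k hk.1
      · simpa only [splice, if_neg hk.2] using h k hk.1
    · rintro ⟨h₁, h₂⟩ k hk
      by_cases hkn : k < n
      · simpa [splice, hkn] using h₁ k ⟨hk, hkn⟩
      · simpa only [splice, if_neg hkn] using h₂ k ⟨hk, hkn⟩
  rw [Measure.map_apply (measurable_splice n)
    (MeasurableSet.pi s.countable_toSet fun k _ => ht k), hpre, Measure.prod_prod,
    Measure.infinitePi_pi μ fun k _ => ht k, Measure.infinitePi_pi μ fun k _ => ht k,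
    Finset.prod_filter_mul_prod_filter_not]

lemma integrable_comp_splice {F : RInfty m → ℝ} (hF : Integrable F (Measure.infinitePi μ))
    (n : ℕ) :
    Integrable (fun p : RInfty m × RInfty m => F (splice n p.1 p.2))
      ((Measure.infinitePi μ).prod (Measure.infinitePi μ)) :=
  (measurePreserving_splice μ n).integrable_comp_of_integrable hF

lemma aestronglyMeasurable_tailAverage {F : RInfty m → ℝ}
    (hF : AEStronglyMeasurable F (Measure.infinitePi μ)) (n : ℕ) :
    AEStronglyMeasurable[cylinderEvents (Set.Iio n)] (tailAverage (Measure.infinitePi μ) F n)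
      (Measure.infinitePi μ) := by
  set P := Measure.infinitePi μ
  have hG := hF.stronglyMeasurable_mk
  refine ⟨tailAverage P (hF.mk F) n, ?_, ?_⟩
  · have h₁ : StronglyMeasurable (tailAverage P (hF.mk F) n) :=
      StronglyMeasurable.integral_prod_right (f := fun x y => hF.mk F (splice n x y))
        (hG.comp_measurable (measurable_splice n))
    -- Factoring through `splice n x 0` upgrades measurability to the first `n` factors.
    have h₂ : tailAverage P (hF.mk F) n =
        tailAverage P (hF.mk F) n ∘ fun x => splice n x 0 := by
      funext x
      simp only [tailAverage, Function.comp_apply, splice_splice_left]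
    rw [h₂]
    exact h₁.comp_measurable (measurable_splice_cylinderEvents n 0)
  -- Splicing preserves the measure, so by Fubini changing `F` on a null set changes its tail
  -- average only on a null set of `x`.
  · have h := (measurePreserving_splice μ n).quasiMeasurePreserving.ae hF.ae_eq_mk
    filter_upwards [Measure.ae_ae_of_ae_prod h] with x hx
    exact integral_congr_ae hx

/-- Averaging over the tail is a version of the conditional expectation. -/
lemma tailAverage_ae_eq_condExp {F : RInfty m → ℝ} (hF : Integrable F (Measure.infinitePi μ))
    (n : ℕ) :
    tailAverage (Measure.infinitePi μ) F n =ᵐ[Measure.infinitePi μ]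
      (Measure.infinitePi μ)[F | cylinderEvents (Set.Iio n)] := by
  set P := Measure.infinitePi μ
  have hint := integrable_comp_splice μ hF n
  refine ae_eq_condExp_of_forall_setIntegral_eq cylinderEvents_le_pi hF
    (fun s _ _ => hint.integral_prod_left.integrableOn) (fun A hA _ => ?_)
    (aestronglyMeasurable_tailAverage μ hF.aestronglyMeasurable n)
  have hA' : MeasurableSet A := cylinderEvents_le_pi A hA
  have hmp := measurePreserving_splice μ n
  -- On the doubled space `A` pulls back to `A ×ˢ univ`, and Fubini then integrates out the
  -- independent tail.
  have hmap : ∫ x in A, F x ∂P = ∫ p in (fun p : RInfty m × RInfty m => splice n p.1 p.2) ⁻¹' A,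
      F (splice n p.1 p.2) ∂(P.prod P) := by
    rw [← setIntegral_map hA' (by rw [hmp.map_eq]; exact hF.aestronglyMeasurable)
      hmp.measurable.aemeasurable, hmp.map_eq]
  rw [hmap]
  have hpre : (fun p : RInfty m × RInfty m => splice n p.1 p.2) ⁻¹' A = A ×ˢ Set.univ := by
    ext p
    simp [mem_splice_iff_of_measurableSet_cylinderEvents hA]
  rw [hpre, setIntegral_prod _ hint.integrableOn]
  simp [tailAverage, P]

/-- The filtration generated by the first `n` factors. -/
def cylinderFiltration (m : ℕ → ℕ) :
    Filtration ℕ (MeasurableSpace.pi : MeasurableSpace (RInfty m)) where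
  seq n := cylinderEvents (Set.Iio n)
  mono' _ _ h := cylinderEvents_mono (Set.Iio_subset_Iio h)
  le' _ := cylinderEvents_le_pi

lemma iSup_cylinderFiltration (m : ℕ → ℕ) :
    ⨆ n, cylinderFiltration m n = MeasurableSpace.pi := by
  refine le_antisymm (iSup_le fun n => cylinderEvents_le_pi) (iSup_le fun k => ?_)
  refine le_iSup_of_le (k + 1) ?_
  exact le_iSup₂_of_le (f := fun i (_ : i ∈ Set.Iio (k + 1)) => MeasurableSpace.comap
    (fun σ : RInfty m => σ i) inferInstance) k (Set.mem_Iio.2 k.lt_succ_self) le_rfl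

/-- The tail averages of an integrable function converge to it almost everywhere. -/
lemma ae_tendsto_tailAverage {F : RInfty m → ℝ} (hF : Integrable F (Measure.infinitePi μ)) :
    ∀ᵐ x ∂(Measure.infinitePi μ),
      Tendsto (fun n => tailAverage (Measure.infinitePi μ) F n x) atTop (𝓝 (F x)) := by
  set P := Measure.infinitePi μ
  have h₁ := tendsto_ae_condExp (μ := P) (ℱ := cylinderFiltration m) F
  rw [iSup_cylinderFiltration] at h₁
  have h₂ : P[F | MeasurableSpace.pi] =ᵐ[P] F :=
    condExp_of_aestronglyMeasurable' le_rfl hF.aestronglyMeasurable hF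
  have h₃ := ae_all_iff.2 fun n => tailAverage_ae_eq_condExp μ hF n
  filter_upwards [h₁, h₂, h₃] with x hx₁ hx₂ hx₃
  rw [← hx₂]
  exact hx₁.congr fun n => (hx₃ n).symm

end Splice

/-! ### Moments of affine functionals under one convex measure -/

section ConvexMoments

/-- The constant comparing the fourth moment of an affine functional under a convex measure
with the fourth power of a `3/4`-quantile of its absolute value. -/
noncomputable def quantileMomentConst : ℝ := 81 + ∑' j : ℕ, (2 * (j : ℝ) + 5) ^ 4 * (1 / 3) ^ j

lemma summable_quantileMomentConst :
    Summable fun j : ℕ => (2 * (j : ℝ) + 5) ^ 4 * (1 / 3 : ℝ) ^ j := by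
  have h : ∀ k : ℕ, Summable fun j : ℕ => (j : ℝ) ^ k * (1 / 3 : ℝ) ^ j := fun k =>
    summable_pow_mul_geometric_of_norm_lt_one k (by norm_num)
  refine (((((h 4).mul_left 16).add ((h 3).mul_left 160)).add ((h 2).mul_left 600)).add
    ((h 1).mul_left 1000)).add ((h 0).mul_left 625) |>.congr fun j => ?_
  ring

lemma le_quantileMomentConst : 81 ≤ quantileMomentConst :=
  le_add_of_nonneg_right (tsum_nonneg fun _ => by positivity)

variable {E : Type*} [AddCommGroup E] [Module ℝ E] [MeasurableSpace E]
  {ν : Measure E} [IsProbabilityMeasure ν]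

/-- Borell's exponential tail bound for an affine functional under a convex measure. -/
lemma IsConvexMeasure.measureReal_lt_abs_sub_le (hν : IsConvexMeasure ν) {l : E →ₗ[ℝ] ℝ}
    (hl : Measurable l) {a c : ℝ} (ha : ν.real {x | a < |l x - c|} ≤ 1 / 4) (j : ℕ) :
    ν.real {x | (2 * (j : ℝ) + 3) * a < |l x - c|} ≤ (1 / 3) ^ j := by
  have hm : Measurable fun x => |l x - c| := by fun_prop
  set A : Set E := {x | |l x - c| ≤ a}
  set B : Set E := {x | (2 * (j : ℝ) + 3) * a < |l x - c|}
  have hA : MeasurableSet A := measurableSet_le hm measurable_const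
  have hB : MeasurableSet B := measurableSet_lt measurable_const hm
  have hAc : {x | a < |l x - c|} = Aᶜ := by ext x; simp [A]
  -- This weight satisfies `t (2j + 3) = 2 - t`: mixing a point of `B` with one of `A` leaves a
  -- deviation above `(2 - t) a - (1 - t) a = a`. Convexity then yields `ν(B)^t · 3/4 ≤ 1/4`.
  set t : ℝ := 1 / ((j : ℝ) + 2) with ht
  have hj : (0 : ℝ) < (j : ℝ) + 2 := by positivity
  have ht0 : 0 < t := by positivity
  have ht1 : t < 1 := by rw [ht, div_lt_one hj]; linarith [Nat.cast_nonneg (α := ℝ) j]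
  have hsub : t • B + (1 - t) • A ⊆ Aᶜ := by
    rintro _ ⟨_, ⟨x, hx, rfl⟩, _, ⟨y, hy, rfl⟩, rfl⟩
    simp only [A, B, Set.mem_ofPred_eq, Set.mem_compl_iff, not_le] at hx hy ⊢
    have h₁ : l (t • x + (1 - t) • y) - c = t * (l x - c) + (1 - t) * (l y - c) := by
      simp only [map_add, map_smul, smul_eq_mul]; ring
    have h₂ : t * ((2 * (j : ℝ) + 3) * a) = (2 - t) * a := by
      rw [ht]; field_simp; ring
    have h₃ : t * |l x - c| ≤ |l (t • x + (1 - t) • y) - c| + (1 - t) * |l y - c| := by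
      have h := abs_sub (t * (l x - c) + (1 - t) * (l y - c)) ((1 - t) * (l y - c))
      rw [add_sub_cancel_right, abs_mul, abs_mul, abs_of_pos ht0,
        abs_of_pos (sub_pos.2 ht1), ← h₁] at h
      exact h
    have h₄ := mul_lt_mul_of_pos_left hx ht0
    have h₅ := mul_le_mul_of_nonneg_left hy (sub_pos.2 ht1).le
    have h₆ : (2 - t) * a = a + (1 - t) * a := by ring
    linarith
  have hmain := (hν B A hB hA t ht0 ht1).trans (measure_mono hsub)
  have hreal : ν.real B ^ t * ν.real A ^ (1 - t) ≤ ν.real Aᶜ := by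
    have h := ENNReal.toReal_mono (measure_ne_top ν _) hmain
    rwa [ENNReal.toReal_mul, ← ENNReal.toReal_rpow, ← ENNReal.toReal_rpow] at h
  rw [hAc] at ha
  have hAc' : ν.real Aᶜ = 1 - ν.real A := probReal_compl_eq_one_sub hA
  have hA34 : 3 / 4 ≤ ν.real A := by linarith
  have hpow : 3 / 4 ≤ ν.real A ^ (1 - t) := by
    refine hA34.trans ?_
    have h := Real.rpow_le_rpow_of_exponent_ge (x := ν.real A) (by linarith) measureReal_le_one
      (show 1 - t ≤ 1 by linarith)
    rwa [Real.rpow_one] at h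
  have hBt : ν.real B ^ t ≤ 1 / 3 := by
    have h0 : 0 ≤ ν.real B ^ t := Real.rpow_nonneg measureReal_nonneg _
    nlinarith
  calc ν.real B = (ν.real B ^ t) ^ (j + 2) := by
        rw [← Real.rpow_natCast, ← Real.rpow_mul measureReal_nonneg, ht]
        push_cast
        rw [one_div_mul_cancel hj.ne', Real.rpow_one]
    _ ≤ (1 / 3) ^ (j + 2) :=
        pow_le_pow_left₀ (Real.rpow_nonneg measureReal_nonneg _) hBt _
    _ ≤ (1 / 3) ^ j := pow_le_pow_of_le_one (by norm_num) (by norm_num) (by lia)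

lemma IsConvexMeasure.fourth_moment_le_of_quantile (hν : IsConvexMeasure ν) {l : E →ₗ[ℝ] ℝ}
    (hl : Measurable l) {a c : ℝ} (ha0 : 0 < a) (ha : ν.real {x | a < |l x - c|} ≤ 1 / 4) :
    Integrable (fun x => (l x - c) ^ 4) ν ∧
      ∫ x, (l x - c) ^ 4 ∂ν ≤ quantileMomentConst * a ^ 4 := by
  have hm : Measurable fun x => |l x - c| := by fun_prop
  set B : ℕ → Set E := fun j => {x | (2 * (j : ℝ) + 3) * a < |l x - c|}
  have hB : ∀ j, MeasurableSet (B j) := fun j => measurableSet_lt measurable_const hm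
  set w : ℕ → ℝ := fun j => ((2 * (j : ℝ) + 5) * a) ^ 4
  have hw : ∀ j, 0 ≤ w j := fun j => by positivity
  have hK : (0 : ℝ) ≤ quantileMomentConst * a ^ 4 :=
    mul_nonneg (by linarith [le_quantileMomentConst]) (by positivity)
  -- Up to `3a` the fourth power is at most `81 a^4`. Beyond that, the least `j` with `|l x - c| ≤
  -- (2j + 5) a` has `x ∈ B j`, and its single term suffices.
  have hpt : ∀ x, ENNReal.ofReal ((l x - c) ^ 4) ≤
      ENNReal.ofReal (81 * a ^ 4) + ∑' j, (B j).indicator (fun _ => ENNReal.ofReal (w j)) x := by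
    intro x
    have hpow : (l x - c) ^ 4 = |l x - c| ^ 4 := by
      rw [← abs_pow, abs_of_nonneg (by positivity)]
    rw [hpow]
    by_cases hx : |l x - c| ≤ 3 * a
    · refine le_add_right (ENNReal.ofReal_le_ofReal ?_)
      calc |l x - c| ^ 4 ≤ (3 * a) ^ 4 := pow_le_pow_left₀ (abs_nonneg _) hx 4
        _ = 81 * a ^ 4 := by ring
    · push Not at hx
      have hex : ∃ j : ℕ, |l x - c| ≤ (2 * (j : ℝ) + 5) * a := by
        obtain ⟨j, hj⟩ := exists_nat_ge (|l x - c| / a)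
        refine ⟨j, ?_⟩
        rw [div_le_iff₀ ha0] at hj
        nlinarith [Nat.cast_nonneg (α := ℝ) j]
      classical
      have hmem : x ∈ B (Nat.find hex) := by
        change (2 * ((Nat.find hex : ℕ) : ℝ) + 3) * a < _
        rcases Nat.eq_zero_or_pos (Nat.find hex) with h0 | h0
        · rw [h0]; simpa using hx
        · have h := Nat.find_min hex (Nat.pred_lt h0.ne')
          rw [not_le, Nat.pred_eq_sub_one, Nat.cast_pred h0] at h
          linarith
      refine le_add_left (le_trans ?_ (ENNReal.le_tsum (Nat.find hex)))
      rw [Set.indicator_of_mem hmem]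
      exact ENNReal.ofReal_le_ofReal (pow_le_pow_left₀ (abs_nonneg _) (Nat.find_spec hex) 4)
  have hsum : Summable fun j : ℕ => w j * (1 / 3 : ℝ) ^ j := by
    refine (summable_quantileMomentConst.mul_left (a ^ 4)).congr fun j => ?_
    simp only [w]; ring
  have hlint : ∫⁻ x, ENNReal.ofReal ((l x - c) ^ 4) ∂ν ≤
      ENNReal.ofReal (quantileMomentConst * a ^ 4) := by
    calc ∫⁻ x, ENNReal.ofReal ((l x - c) ^ 4) ∂ν
        ≤ ∫⁻ x, (ENNReal.ofReal (81 * a ^ 4) +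
            ∑' j, (B j).indicator (fun _ => ENNReal.ofReal (w j)) x) ∂ν := lintegral_mono hpt
      _ = ENNReal.ofReal (81 * a ^ 4) + ∑' j, ENNReal.ofReal (w j) * ν (B j) := by
          rw [lintegral_add_left measurable_const, lintegral_tsum fun j =>
            (measurable_const.indicator (hB j)).aemeasurable]
          simp [lintegral_indicator_const (hB _)]
      _ ≤ ENNReal.ofReal (81 * a ^ 4) + ∑' j : ℕ, ENNReal.ofReal (w j * (1 / 3 : ℝ) ^ j) := by
          gcongr with j
          rw [ENNReal.ofReal_mul (hw j)]
          gcongr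
          rw [← ofReal_measureReal]
          exact ENNReal.ofReal_le_ofReal (hν.measureReal_lt_abs_sub_le hl ha j)
      _ = ENNReal.ofReal (quantileMomentConst * a ^ 4) := by
          rw [← ENNReal.ofReal_tsum_of_nonneg (fun j => mul_nonneg (hw j) (by positivity)) hsum,
            ← ENNReal.ofReal_add (by positivity)
              (tsum_nonneg fun j => mul_nonneg (hw j) (by positivity))]
          congr 1
          rw [quantileMomentConst, add_mul, ← tsum_mul_right]
          congr 2
          funext j
          simp only [w]; ring
  have hmeas : AEStronglyMeasurable (fun x => (l x - c) ^ 4) ν := by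
    exact Measurable.aestronglyMeasurable (by fun_prop)
  have hnn : 0 ≤ᵐ[ν] fun x => (l x - c) ^ 4 := ae_of_all _ fun x => by positivity
  refine ⟨(lintegral_ofReal_ne_top_iff_integrable hmeas hnn).1
    (ne_top_of_le_ne_top ENNReal.ofReal_ne_top hlint), ?_⟩
  rw [integral_eq_lintegral_of_nonneg_ae hnn hmeas]
  exact ENNReal.toReal_le_of_le_ofReal hK hlint

/-- Continuity from above, since `F` is finite everywhere. This provides quantiles before any moment
is known to exist. -/
lemma exists_pos_measureReal_lt_abs_le {α : Type*} [MeasurableSpace α] {P : Measure α}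
    [IsFiniteMeasure P] {F : α → ℝ} (hF : AEMeasurable F P) {ε : ℝ} (hε : 0 < ε) :
    ∃ a, 0 < a ∧ P.real {x | a < |F x|} ≤ ε := by
  have hanti : Antitone fun n : ℕ => {x | (n : ℝ) < |F x|} := fun i j hij x hx => by
    simp only [Set.mem_ofPred_eq] at hx ⊢
    exact lt_of_le_of_lt (Nat.cast_le.2 hij) hx
  have h := tendsto_measure_iInter_atTop (μ := P)
    (fun n : ℕ => nullMeasurableSet_lt (aemeasurable_const (b := (n : ℝ))) hF.abs)
    hanti ⟨0, measure_ne_top P _⟩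
  have hempty : ⋂ n : ℕ, {x | (n : ℝ) < |F x|} = ∅ := by
    ext x
    simp only [Set.mem_iInter, Set.mem_ofPred_eq, Set.mem_empty_iff_false, iff_false, not_forall,
      not_lt]
    exact exists_nat_ge _
  rw [hempty, measure_empty] at h
  obtain ⟨n, hn, hn0⟩ := ((h.eventually_lt_const (ENNReal.ofReal_pos.2 hε)).and
    (eventually_gt_atTop 0)).exists
  exact ⟨n, Nat.cast_pos.2 hn0, ENNReal.toReal_le_of_le_ofReal hε.le hn.le⟩

lemma IsConvexMeasure.memLp_four (hν : IsConvexMeasure ν) {l : E →ₗ[ℝ] ℝ} (hl : Measurable l) :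
    MemLp l 4 ν := by
  obtain ⟨a, ha0, ha⟩ := exists_pos_measureReal_lt_abs_le (P := ν) hl.aemeasurable
    (show (0 : ℝ) < 1 / 4 by norm_num)
  have h := (hν.fourth_moment_le_of_quantile hl (c := 0) ha0 (by simpa using ha)).1
  rw [← integrable_norm_rpow_iff hl.aestronglyMeasurable (by norm_num) (by norm_num)]
  refine h.congr (ae_of_all _ fun x => ?_)
  have h4 : ((4 : ℝ≥0∞).toReal) = ((4 : ℕ) : ℝ) := by norm_num
  simp only [sub_zero, h4, Real.rpow_natCast, Real.norm_eq_abs]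
  rw [← abs_pow, abs_of_nonneg (by positivity)]

/-- The reverse Hölder inequality for affine functionals under a convex measure. -/
lemma IsConvexMeasure.fourth_moment_le (hν : IsConvexMeasure ν) {l : E →ₗ[ℝ] ℝ}
    (hl : Measurable l) (c : ℝ) :
    ∫ x, (l x - c) ^ 4 ∂ν ≤ 16 * quantileMomentConst * (∫ x, (l x - c) ^ 2 ∂ν) ^ 2 := by
  have hmem : MemLp (fun x => l x - c) 2 ν :=
    ((hν.memLp_four hl).mono_exponent (by norm_num)).sub (memLp_const c)
  have hint : Integrable (fun x => (l x - c) ^ 2) ν := hmem.integrable_sq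
  set V := ∫ x, (l x - c) ^ 2 ∂ν with hV
  have hV0 : 0 ≤ V := integral_nonneg fun x => by positivity
  rcases hV0.eq_or_lt with h0 | hpos
  · have hz : (fun x => (l x - c) ^ 2) =ᵐ[ν] 0 :=
      (integral_eq_zero_iff_of_nonneg (fun x => by positivity) hint).1 h0.symm
    have hz' : (fun x => (l x - c) ^ 4) =ᵐ[ν] 0 := by
      filter_upwards [hz] with x hx
      have : l x - c = 0 := by simpa using hx
      simp [this]
    rw [integral_eq_zero_of_ae hz', ← h0]
    simp
  · have hσ : 0 < Real.sqrt V := Real.sqrt_pos.2 hpos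
    -- Chebyshev makes `2 √V` an admissible quantile; its fourth power produces the factor `16`.
    have hcheb := mul_meas_ge_le_integral_of_nonneg (μ := ν)
      (ae_of_all _ fun x => by positivity) hint (4 * V)
    have hsub : {x | 2 * Real.sqrt V < |l x - c|} ⊆ {x | 4 * V ≤ (l x - c) ^ 2} := by
      intro x hx
      have hx' : 2 * Real.sqrt V < |l x - c| := hx
      change 4 * V ≤ (l x - c) ^ 2
      rw [← sq_abs (l x - c)]
      nlinarith [Real.sq_sqrt hV0]
    have hq : ν.real {x | 2 * Real.sqrt V < |l x - c|} ≤ 1 / 4 := by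
      refine (measureReal_mono hsub).trans ?_
      nlinarith
    refine (hν.fourth_moment_le_of_quantile hl (by positivity) hq).2.trans_eq ?_
    have : (2 * Real.sqrt V) ^ 4 = 16 * (Real.sqrt V ^ 2) ^ 2 := by ring
    rw [this, Real.sq_sqrt hV0]
    ring

end ConvexMoments

/-! ### Fourth-moment comparison for independent sums, and Paley–Zygmund -/

section IndependentSums

open ProbabilityTheory

variable {Ω : Type*} [MeasurableSpace Ω] {P : Measure Ω} [IsProbabilityMeasure P]

lemma MeasureTheory.MemLp.integrable_pow_of_le_four {X : Ω → ℝ} (hX : MemLp X 4 P) {k : ℕ}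
    (hk : k ≤ 4) : Integrable (fun ω => X ω ^ k) P := by
  rcases Nat.eq_zero_or_pos k with rfl | hk0
  · simp
  · have hk' : (k : ℝ≥0∞) ≤ 4 := by exact_mod_cast hk
    have h := (hX.mono_exponent hk').integrable_norm_pow hk0.ne'
    refine (integrable_norm_iff (hX.aestronglyMeasurable.pow k)).1 (h.congr ?_)
    exact ae_of_all _ fun ω => by simp

lemma ProbabilityTheory.IndepFun.integral_pow_mul_pow {X Y : Ω → ℝ} (h : IndepFun X Y P)
    (hX : MemLp X 4 P) (hY : MemLp Y 4 P) {i j : ℕ} (hi : i ≤ 4) (hj : j ≤ 4) :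
    Integrable (fun ω => X ω ^ i * Y ω ^ j) P ∧
      ∫ ω, X ω ^ i * Y ω ^ j ∂P = (∫ ω, X ω ^ i ∂P) * ∫ ω, Y ω ^ j ∂P := by
  have hind : IndepFun (fun ω => X ω ^ i) (fun ω => Y ω ^ j) P :=
    h.comp (φ := fun x : ℝ => x ^ i) (ψ := fun x : ℝ => x ^ j) (by fun_prop) (by fun_prop)
  have hX' := hX.integrable_pow_of_le_four hi
  have hY' := hY.integrable_pow_of_le_four hj
  exact ⟨hind.integrable_mul hX' hY', hind.integral_fun_mul_eq_mul_integral
    hX'.aestronglyMeasurable hY'.aestronglyMeasurable⟩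

/-- Comparison of fourth and second moments passes to sums of independent centred variables. -/
lemma fourth_moment_add_le {C : ℝ} (hC : 3 ≤ C) {X Y : Ω → ℝ} (h : IndepFun X Y P)
    (hX : MemLp X 4 P) (hY : MemLp Y 4 P) (hX0 : ∫ ω, X ω ∂P = 0) (hY0 : ∫ ω, Y ω ∂P = 0)
    (hXC : ∫ ω, X ω ^ 4 ∂P ≤ C * (∫ ω, X ω ^ 2 ∂P) ^ 2)
    (hYC : ∫ ω, Y ω ^ 4 ∂P ≤ C * (∫ ω, Y ω ^ 2 ∂P) ^ 2) :
    ∫ ω, (X ω + Y ω) ^ 4 ∂P ≤ C * (∫ ω, (X ω + Y ω) ^ 2 ∂P) ^ 2 := by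
  have e := fun {i j : ℕ} (hi : i ≤ 4) (hj : j ≤ 4) => h.integral_pow_mul_pow hX hY hi hj
  have i₁ := hX.integrable_pow_of_le_four le_rfl
  have i₂ := hY.integrable_pow_of_le_four le_rfl
  have i₃ := hX.integrable_pow_of_le_four (k := 2) (by norm_num)
  have i₄ := hY.integrable_pow_of_le_four (k := 2) (by norm_num)
  have e31 := e (i := 3) (j := 1) (by norm_num) (by norm_num)
  have e22 := e (i := 2) (j := 2) (by norm_num) (by norm_num)
  have e13 := e (i := 1) (j := 3) (by norm_num) (by norm_num)
  have e11 := e (i := 1) (j := 1) (by norm_num) (by norm_num)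
  have h4 : ∫ ω, (X ω + Y ω) ^ 4 ∂P =
      ∫ ω, X ω ^ 4 ∂P + 6 * ((∫ ω, X ω ^ 2 ∂P) * ∫ ω, Y ω ^ 2 ∂P) + ∫ ω, Y ω ^ 4 ∂P := by
    have hexp : ∀ ω, (X ω + Y ω) ^ 4 = X ω ^ 4 + 4 * (X ω ^ 3 * Y ω ^ 1) +
        6 * (X ω ^ 2 * Y ω ^ 2) + 4 * (X ω ^ 1 * Y ω ^ 3) + Y ω ^ 4 := fun ω => by ring
    simp_rw [hexp]
    have a1 := i₁.add (e31.1.const_mul 4)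
    have a2 := a1.add (e22.1.const_mul 6)
    have a3 := a2.add (e13.1.const_mul 4)
    simp only [Pi.add_def] at a1 a2 a3
    rw [integral_add a3 i₂, integral_add a2 (e13.1.const_mul 4),
      integral_add a1 (e22.1.const_mul 6), integral_add i₁ (e31.1.const_mul 4),
      integral_const_mul, integral_const_mul, integral_const_mul, e31.2, e22.2, e13.2]
    simp only [pow_one, hX0, hY0]
    ring
  have h2 : ∫ ω, (X ω + Y ω) ^ 2 ∂P = ∫ ω, X ω ^ 2 ∂P + ∫ ω, Y ω ^ 2 ∂P := by
    have hexp : ∀ ω, (X ω + Y ω) ^ 2 = X ω ^ 2 + 2 * (X ω ^ 1 * Y ω ^ 1) + Y ω ^ 2 :=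
      fun ω => by ring
    simp_rw [hexp]
    have a1 := i₃.add (e11.1.const_mul 2)
    simp only [Pi.add_def] at a1
    rw [integral_add a1 i₄, integral_add i₃ (e11.1.const_mul 2), integral_const_mul, e11.2]
    simp only [pow_one, hX0, hY0]
    ring
  rw [h4, h2]
  have hx : 0 ≤ ∫ ω, X ω ^ 2 ∂P := integral_nonneg fun ω => by positivity
  have hy : 0 ≤ ∫ ω, Y ω ^ 2 ∂P := integral_nonneg fun ω => by positivity
  -- The mixed term `6 E X² E Y²` is absorbed by `2C E X² E Y²`, as `C ≥ 3`.
  nlinarith [mul_nonneg hx hy]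

lemma fourth_moment_sum_range_le {C : ℝ} (hC : 3 ≤ C) {ξ : ℕ → Ω → ℝ} (hind : iIndepFun ξ P)
    (hmeas : ∀ k, Measurable (ξ k)) (hξ : ∀ k, MemLp (ξ k) 4 P) (h0 : ∀ k, ∫ ω, ξ k ω ∂P = 0)
    (hξC : ∀ k, ∫ ω, ξ k ω ^ 4 ∂P ≤ C * (∫ ω, ξ k ω ^ 2 ∂P) ^ 2) (n : ℕ) :
    ∫ ω, (∑ k ∈ Finset.range n, ξ k ω) ^ 4 ∂P ≤
      C * (∫ ω, (∑ k ∈ Finset.range n, ξ k ω) ^ 2 ∂P) ^ 2 := by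
  induction n with
  | zero => simp
  | succ n ih =>
    simp only [Finset.sum_range_succ]
    have hi := hind.indepFun_sum_range_succ hmeas n
    have hsum : (∑ j ∈ Finset.range n, ξ j) = fun ω => ∑ j ∈ Finset.range n, ξ j ω := by
      funext ω; simp
    rw [hsum] at hi
    refine fourth_moment_add_le hC hi (memLp_finsetSum _ fun k _ => hξ k) (hξ n) ?_ (h0 n) ih
      (hξC n)
    rw [integral_finsetSum _ fun k _ => (hξ k).integrable (by norm_num)]
    exact Finset.sum_eq_zero fun k _ => h0 k

/-- The factor `8` comes from `(X + b)^4 ≤ 8 X^4 + 8 b^4`; centring gives `E (X + b)^2 = E X^2 +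
b^2`. The constant does not depend on `b`, which is essential because the affine approximants have
uncontrolled constants. -/
lemma fourth_moment_add_const_le {C : ℝ} (hC : 3 ≤ C) {X : Ω → ℝ} (hX : MemLp X 4 P)
    (hX0 : ∫ ω, X ω ∂P = 0) (hXC : ∫ ω, X ω ^ 4 ∂P ≤ C * (∫ ω, X ω ^ 2 ∂P) ^ 2) (b : ℝ) :
    ∫ ω, (X ω + b) ^ 4 ∂P ≤ 8 * C * (∫ ω, (X ω + b) ^ 2 ∂P) ^ 2 := by
  have i₁ := hX.integrable_pow_of_le_four le_rfl
  have i₂ := hX.integrable_pow_of_le_four (k := 2) (by norm_num)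
  have i₃ : Integrable X P := hX.integrable (by norm_num)
  have h2 : ∫ ω, (X ω + b) ^ 2 ∂P = ∫ ω, X ω ^ 2 ∂P + b ^ 2 := by
    have hexp : ∀ ω, (X ω + b) ^ 2 = X ω ^ 2 + 2 * b * X ω + b ^ 2 := fun ω => by ring
    simp_rw [hexp]
    have a1 := i₂.add (i₃.const_mul (2 * b))
    simp only [Pi.add_def] at a1
    rw [integral_add a1 (integrable_const _), integral_add i₂ (i₃.const_mul _),
      integral_const_mul, hX0]
    simp
  have h4 : ∫ ω, (X ω + b) ^ 4 ∂P ≤ 8 * ∫ ω, X ω ^ 4 ∂P + 8 * b ^ 4 := by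
    have hle := integral_mono
      ((hX.add (memLp_const b)).integrable_pow_of_le_four (k := 4) le_rfl)
      ((i₁.const_mul 8).add (integrable_const (8 * b ^ 4)))
      (fun ω => show (X ω + b) ^ 4 ≤ 8 * X ω ^ 4 + 8 * b ^ 4 by
        nlinarith [sq_nonneg (X ω ^ 2 - b ^ 2), sq_nonneg (X ω - b), sq_nonneg (X ω + b),
          mul_nonneg (sq_nonneg (X ω - b)) (sq_nonneg (X ω + b)),
          mul_nonneg (sq_nonneg (X ω - b)) (sq_nonneg (X ω)),
          mul_nonneg (sq_nonneg (X ω - b)) (sq_nonneg b), sq_nonneg ((X ω - b) ^ 2)])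
    refine hle.trans_eq ?_
    change ∫ ω, (8 * X ω ^ 4 + 8 * b ^ 4) ∂P = _
    rw [integral_add (i₁.const_mul 8) (integrable_const _), integral_const_mul]
    simp
  rw [h2]
  have hx : 0 ≤ ∫ ω, X ω ^ 2 ∂P := integral_nonneg fun ω => by positivity
  have hb : 0 ≤ b ^ 2 := sq_nonneg b
  nlinarith [mul_nonneg hx hb, mul_nonneg (mul_nonneg hx hb) (show 0 ≤ C by linarith),
    mul_nonneg (show 0 ≤ C - 3 by linarith) (sq_nonneg (b ^ 2))]

/-- A Paley–Zygmund bound: comparable fourth and second moments control the second moment by a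
quantile. -/
lemma second_moment_le_of_quantile {D : ℝ} (hD : 0 < D) {U : Ω → ℝ} (hU : MemLp U 4 P)
    (hUD : ∫ ω, U ω ^ 4 ∂P ≤ D * (∫ ω, U ω ^ 2 ∂P) ^ 2) {t : ℝ}
    (htail : P.real {ω | t < |U ω|} ≤ 1 / (4 * D)) :
    ∫ ω, U ω ^ 2 ∂P ≤ 2 * t ^ 2 := by
  have i₁ := hU.integrable_pow_of_le_four le_rfl
  have i₂ := hU.integrable_pow_of_le_four (k := 2) (by norm_num)
  set V := ∫ ω, U ω ^ 2 ∂P with hV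
  have hV0 : 0 ≤ V := integral_nonneg fun ω => by positivity
  rcases hV0.eq_or_lt with h0 | hpos
  · rw [← h0]; positivity
  set G : Set Ω := {ω | t < |U ω|}
  have hG : NullMeasurableSet G P :=
    nullMeasurableSet_lt aemeasurable_const hU.aestronglyMeasurable.aemeasurable.abs
  have hGint : Integrable (G.indicator fun _ => (1 : ℝ)) P :=
    (integrable_const (1 : ℝ)).indicator₀ hG
  have hGval : ∫ ω, G.indicator (fun _ => (1 : ℝ)) ω ∂P = P.real G := by
    rw [integral_indicator₀ hG]; simp
  set r : ℝ := 1 / (4 * D * V)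
  have hr : 0 < r := by positivity
  -- On `G` this is AM–GM with `r · D V = 1/4`. With this `r`, each of the last two terms integrates
  -- to at most `V / 4`.
  have hpt : ∀ ω, U ω ^ 2 ≤ t ^ 2 + r * U ω ^ 4 + D * V * G.indicator (fun _ => (1 : ℝ)) ω := by
    intro ω
    have hrr : r * (D * V) = 1 / 4 := by simp only [r]; field_simp
    by_cases hω : ω ∈ G
    · rw [Set.indicator_of_mem hω, mul_one]
      have hsq : 0 ≤ r * (U ω ^ 2 - 2 * (D * V)) ^ 2 := by positivity
      have : r * (U ω ^ 2 - 2 * (D * V)) ^ 2 =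
          r * U ω ^ 4 - 4 * (r * (D * V)) * U ω ^ 2 + 4 * (r * (D * V)) * (D * V) := by ring
      rw [this, hrr] at hsq
      nlinarith [sq_nonneg t]
    · rw [Set.indicator_of_notMem hω, mul_zero, add_zero]
      have hω' : |U ω| ≤ t := not_lt.1 hω
      have : U ω ^ 2 ≤ t ^ 2 := by
        rw [← sq_abs]; exact pow_le_pow_left₀ (abs_nonneg _) hω' 2
      have : 0 ≤ r * U ω ^ 4 := by positivity
      linarith
  have a1 := (integrable_const (μ := P) (t ^ 2)).add (i₁.const_mul r)
  have a2 := a1.add (hGint.const_mul (D * V))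
  simp only [Pi.add_def] at a1 a2
  have hle := integral_mono i₂ a2 hpt
  rw [integral_add a1 (hGint.const_mul (D * V)), integral_add (integrable_const _)
    (i₁.const_mul r), integral_const_mul, integral_const_mul, hGval] at hle
  have h1 : r * ∫ ω, U ω ^ 4 ∂P ≤ V / 4 := by
    calc r * ∫ ω, U ω ^ 4 ∂P ≤ r * (D * V ^ 2) := mul_le_mul_of_nonneg_left hUD hr.le
      _ = V / 4 := by simp only [r]; field_simp
  have h2 : D * V * P.real G ≤ V / 4 := by
    calc D * V * P.real G ≤ D * V * (1 / (4 * D)) :=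
          mul_le_mul_of_nonneg_left htail (by positivity)
      _ = V / 4 := by field_simp
  simp only [integral_const, probReal_univ, one_smul] at hle
  linarith

end IndependentSums

/-! ### Linear functionals on the product space and their integrability -/

section LinearFunctional

variable {m : ℕ → ℕ}

/-- The restriction of a linear functional on `ℝ^∞` to its `k`-th factor. -/
noncomputable def coordFunctional (f : RInfty m →ₗ[ℝ] ℝ) (k : ℕ) :
    EuclideanSpace ℝ (Fin (m k)) →L[ℝ] ℝ :=
  (f ∘ₗ LinearMap.single ℝ (fun k => EuclideanSpace ℝ (Fin (m k))) k).toContinuousLinearMap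

/-- The continuous linear functional obtained from `f` by discarding all but the first `n`
factors. -/
noncomputable def headFunctional (f : RInfty m →ₗ[ℝ] ℝ) (n : ℕ) : RInfty m →L[ℝ] ℝ :=
  ∑ k ∈ Finset.range n, (coordFunctional f k).comp (ContinuousLinearMap.proj k)

lemma headFunctional_apply (f : RInfty m →ₗ[ℝ] ℝ) (n : ℕ) (x : RInfty m) :
    headFunctional f n x = ∑ k ∈ Finset.range n, coordFunctional f k (x k) := by
  simp [headFunctional]

lemma map_splice_zero (f : RInfty m →ₗ[ℝ] ℝ) (n : ℕ) (x : RInfty m) :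
    f (splice n x 0) = headFunctional f n x := by
  have h : splice n x 0 = ∑ k ∈ Finset.range n, (Pi.single k (x k) : RInfty m) := by
    funext j
    rw [Finset.sum_apply]
    by_cases hj : j < n
    · rw [splice_of_lt hj, Finset.sum_eq_single_of_mem j (Finset.mem_range.2 hj)
        (fun k _ hk => Pi.single_eq_of_ne' hk _), Pi.single_eq_same]
    · rw [splice_of_le (not_lt.1 hj), Finset.sum_eq_zero]
      · rfl
      · intro k hk
        exact Pi.single_eq_of_ne' (by have := Finset.mem_range.1 hk; lia) _
  rw [h, map_sum, headFunctional_apply]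
  rfl

/-- Linearity separates head from tail, so freezing the head `x` alters `f` only by a constant and
by `headFunctional f n y`. -/
lemma map_splice (f : RInfty m →ₗ[ℝ] ℝ) (n : ℕ) (x y : RInfty m) :
    f (splice n x y) = headFunctional f n x + (f y - headFunctional f n y) := by
  have hy : f y = headFunctional f n y + f (splice n 0 y) := by
    rw [← map_splice_zero, ← map_add, ← splice_eq_add, splice_self]
  rw [splice_eq_add, map_add, map_splice_zero, hy, add_sub_cancel_left]

lemma dependsOn_headFunctional (f : RInfty m →ₗ[ℝ] ℝ) (n : ℕ) :
    DependsOn (headFunctional f n) (Set.Iio n) := by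
  intro x y h
  rw [headFunctional_apply, headFunctional_apply]
  exact Finset.sum_congr rfl fun k hk => by rw [h k (Finset.mem_range.1 hk)]

/-- A point `p` of `s` lies outside the direction of the span, as otherwise the span would contain
`0`. A functional vanishing on the direction but not at `p` is then normalised at `p`. -/
lemma exists_dual_eq_one_of_zero_notMem_affineSpan {V : Type*} [AddCommGroup V] [Module ℝ V]
    {s : Set V} (hs : (0 : V) ∉ affineSpan ℝ s) : ∃ l : V →ₗ[ℝ] ℝ, ∀ x ∈ s, l x = 1 := by
  rcases s.eq_empty_or_nonempty with rfl | ⟨p, hp⟩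
  · exact ⟨0, by simp⟩
  have hpS := subset_affineSpan ℝ s hp
  have hpd : p ∉ (affineSpan ℝ s).direction := by
    intro hd
    refine hs ?_
    have h := AffineSubspace.vadd_mem_of_mem_direction (neg_mem hd) hpS
    simpa using h
  obtain ⟨l, hlp, hl⟩ := Submodule.exists_le_ker_of_notMem hpd
  refine ⟨(l p)⁻¹ • l, fun x hx => ?_⟩
  have hker : l (x - p) = 0 :=
    hl (AffineSubspace.vsub_mem_direction (subset_affineSpan ℝ s hx) hpS)
  rw [map_sub, sub_eq_zero] at hker
  rw [LinearMap.smul_apply, hker, smul_eq_mul, inv_mul_cancel₀ hlp]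

/-- Monotone convergence along the truncation levels `N + 1`. -/
lemma integrable_of_forall_integral_min_le {α : Type*} [MeasurableSpace α] {P : Measure α}
    [IsFiniteMeasure P] {F : α → ℝ} (hF : AEMeasurable F P) {M : ℝ}
    (h : ∀ N : ℕ, 1 ≤ N → ∫ x, min |F x| N ∂P ≤ M) : Integrable F P := by
  have hmono : ∀ᵐ x ∂P, Monotone fun N : ℕ => ENNReal.ofReal (min |F x| ((N : ℝ) + 1)) :=
    ae_of_all _ fun x i j hij => ENNReal.ofReal_le_ofReal
      (min_le_min le_rfl (by have : (i : ℝ) ≤ j := Nat.cast_le.2 hij; linarith))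
  have hlim : ∀ᵐ x ∂P, Tendsto (fun N : ℕ => ENNReal.ofReal (min |F x| ((N : ℝ) + 1))) atTop
      (𝓝 (ENNReal.ofReal |F x|)) := by
    refine ae_of_all _ fun x => tendsto_const_nhds.congr' ?_
    obtain ⟨N, hN⟩ := exists_nat_ge |F x|
    filter_upwards [eventually_ge_atTop N] with k hk
    have : (N : ℝ) ≤ k := Nat.cast_le.2 hk
    rw [min_eq_left (by linarith)]
  have ht := lintegral_tendsto_of_tendsto_of_monotone (fun N : ℕ => by fun_prop) hmono hlim
  have hle : ∫⁻ x, ENNReal.ofReal |F x| ∂P ≤ ENNReal.ofReal M := by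
    refine le_of_tendsto' ht fun N => ?_
    have hnn : ∀ x, 0 ≤ min |F x| ((N : ℝ) + 1) := fun x => le_min (abs_nonneg _) (by positivity)
    have hint : Integrable (fun x => min |F x| ((N : ℝ) + 1)) P := by
      refine Integrable.of_bound (AEMeasurable.aestronglyMeasurable (by fun_prop)) ((N : ℝ) + 1)
        (ae_of_all _ fun x => ?_)
      rw [Real.norm_of_nonneg (hnn x)]
      exact min_le_right _ _
    rw [← ofReal_integral_eq_lintegral_ofReal hint (ae_of_all _ hnn)]
    refine ENNReal.ofReal_le_ofReal ?_
    have := h (N + 1) (by lia)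
    rwa [Nat.cast_succ] at this
  refine ⟨hF.aestronglyMeasurable, ?_⟩
  rw [hasFiniteIntegral_iff_norm]
  exact hle.trans_lt ENNReal.ofReal_lt_top

variable {μ : (k : ℕ) → Measure (EuclideanSpace ℝ (Fin (m k)))} [∀ k, IsProbabilityMeasure (μ k)]

lemma integrable_min_abs_one {α : Type*} [MeasurableSpace α] {P : Measure α} [IsFiniteMeasure P]
    {F : α → ℝ} (hF : AEMeasurable F P) : Integrable (fun x => min |F x| 1) P := by
  refine Integrable.of_bound (AEMeasurable.aestronglyMeasurable (by fun_prop)) 1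
    (ae_of_all _ fun x => ?_)
  rw [Real.norm_of_nonneg (le_min (abs_nonneg _) zero_le_one)]
  exact min_le_right _ _

/-- A measurable linear functional is approximated in probability by continuous affine functions
of finitely many factors. -/
lemma exists_headFunctional_approx {f : RInfty m →ₗ[ℝ] ℝ}
    (hf : AEMeasurable f (Measure.infinitePi μ)) {ε : ℝ} (hε : 0 < ε) :
    ∃ (n : ℕ) (b : ℝ),
      ∫ y, min |f y - (headFunctional f n y + b)| 1 ∂(Measure.infinitePi μ) ≤ ε := by
  set P := Measure.infinitePi μ
  -- Countably many such sets cover the space, so one has positive measure and contains a point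
  -- where the martingale converges.
  obtain ⟨c, hc⟩ : ∃ c : ℚ, P {x | |f x - c| < ε} ≠ 0 := by
    by_contra! hall
    have hcover : (Set.univ : Set (RInfty m)) ⊆ ⋃ c : ℚ, {x | |f x - c| < ε} := by
      intro x _
      obtain ⟨c, hc₁, hc₂⟩ := exists_rat_btwn (show f x - ε < f x by linarith)
      refine Set.mem_iUnion.2 ⟨c, ?_⟩
      change |f x - c| < ε
      rw [abs_lt]
      constructor <;> linarith
    have h := measure_mono_null hcover (measure_iUnion_null hall)
    simp [P] at h
  have hint := integrable_min_abs_one (P := P) (hf.sub_const (c : ℝ))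
  obtain ⟨x, hx, hxlim⟩ : ∃ x, |f x - c| < ε ∧ Tendsto (fun n =>
      tailAverage P (fun x => min |f x - c| 1) n x) atTop (𝓝 (min |f x - c| 1)) := by
    have hfreq : ∃ᵐ x ∂P, |f x - c| < ε := by
      rwa [frequently_ae_iff]
    exact (hfreq.and_eventually (ae_tendsto_tailAverage μ hint)).exists
  obtain ⟨n, hn⟩ := (hxlim.eventually_lt_const ((min_le_left _ _).trans_lt hx)).exists
  -- With `x` frozen, `f (splice n x y) - c` equals `f y - (headFunctional f n y + b)` for this `b`.
  refine ⟨n, c - headFunctional f n x, le_trans (le_of_eq ?_) hn.le⟩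
  refine integral_congr_ae (ae_of_all _ fun y => ?_)
  simp only [map_splice]
  congr 2
  ring

lemma memLp_four_coordFunctional (hconv : ∀ k, IsConvexMeasure (μ k)) (f : RInfty m →ₗ[ℝ] ℝ) (k : ℕ) :
    MemLp (fun x : RInfty m => coordFunctional f k (x k)) 4 (Measure.infinitePi μ) :=
  ((hconv k).memLp_four (l := (coordFunctional f k).toLinearMap)
    (coordFunctional f k).measurable).comp_measurePreserving (measurePreserving_eval_infinitePi μ k)

lemma memLp_four_headFunctional (hconv : ∀ k, IsConvexMeasure (μ k)) (f : RInfty m →ₗ[ℝ] ℝ)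
    (n : ℕ) : MemLp (headFunctional f n) 4 (Measure.infinitePi μ) := by
  have h : (headFunctional f n : RInfty m → ℝ) =
      fun x => ∑ k ∈ Finset.range n, coordFunctional f k (x k) :=
    funext fun x => headFunctional_apply f n x
  rw [h]
  exact memLp_finsetSum _ fun k _ => memLp_four_coordFunctional hconv f k

lemma fourth_moment_headFunctional_add_const_le (hconv : ∀ k, IsConvexMeasure (μ k))
    (f : RInfty m →ₗ[ℝ] ℝ) (n : ℕ) (b : ℝ) :
    ∫ x, (headFunctional f n x + b) ^ 4 ∂(Measure.infinitePi μ) ≤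
      8 * (16 * quantileMomentConst) *
        (∫ x, (headFunctional f n x + b) ^ 2 ∂(Measure.infinitePi μ)) ^ 2 := by
  set P := Measure.infinitePi μ
  have hC : 3 ≤ 16 * quantileMomentConst := by linarith [le_quantileMomentConst]
  set a : ℕ → ℝ := fun k => ∫ x, coordFunctional f k (x k) ∂P
  set η : (k : ℕ) → EuclideanSpace ℝ (Fin (m k)) → ℝ := fun k v => coordFunctional f k v - a k
  have hη : ∀ k, Measurable (η k) := fun k => (coordFunctional f k).measurable.sub_const _
  set ξ : ℕ → RInfty m → ℝ := fun k x => η k (x k)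
  have hind : ProbabilityTheory.iIndepFun ξ P := ProbabilityTheory.iIndepFun_infinitePi hη
  have hmeas : ∀ k, Measurable (ξ k) := fun k => (hη k).comp (measurable_pi_apply k)
  have hLp : ∀ k, MemLp (ξ k) 4 P := fun k =>
    (memLp_four_coordFunctional hconv f k).sub (memLp_const (a k))
  have h0 : ∀ k, ∫ x, ξ k x ∂P = 0 := fun k => by
    have h := integral_sub ((memLp_four_coordFunctional hconv f k).integrable (by norm_num))
      (integrable_const (μ := P) (a k))
    simp only [integral_const, probReal_univ, one_smul] at h
    exact h.trans (sub_self _)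
  have htransfer : ∀ k i, ∫ x, ξ k x ^ i ∂P = ∫ v, η k v ^ i ∂(μ k) := fun k i => by
    have hmp := measurePreserving_eval_infinitePi μ k
    rw [← hmp.map_eq, integral_map hmp.measurable.aemeasurable
      ((hη k).pow_const i).aestronglyMeasurable]
  have hfour : ∀ k, ∫ x, ξ k x ^ 4 ∂P ≤
      16 * quantileMomentConst * (∫ x, ξ k x ^ 2 ∂P) ^ 2 := fun k => by
    rw [htransfer, htransfer]
    exact (hconv k).fourth_moment_le (l := (coordFunctional f k).toLinearMap)
      (coordFunctional f k).measurable (a k)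
  have hsum := fourth_moment_sum_range_le hC hind hmeas hLp h0 hfour n
  have hsum0 : ∫ x, ∑ k ∈ Finset.range n, ξ k x ∂P = 0 := by
    rw [integral_finsetSum _ fun k _ => (hLp k).integrable (by norm_num)]
    exact Finset.sum_eq_zero fun k _ => h0 k
  have h := fourth_moment_add_const_le hC (memLp_finsetSum (Finset.range n) fun k _ => hLp k) hsum0
    hsum (∑ k ∈ Finset.range n, a k + b)
  have heq : ∀ x, ∑ k ∈ Finset.range n, ξ k x + (∑ k ∈ Finset.range n, a k + b) =
      headFunctional f n x + b := fun x => by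
    rw [headFunctional_apply, ← add_assoc, ← Finset.sum_add_distrib]
    simp [ξ, η]
  simpa only [heq] using h

/-- A measurable linear functional is integrable under a product of convex measures. -/
theorem integrable_linear_of_isConvexMeasure (hconv : ∀ k, IsConvexMeasure (μ k))
    {f : RInfty m →ₗ[ℝ] ℝ} (hf : AEMeasurable f (Measure.infinitePi μ)) :
    Integrable f (Measure.infinitePi μ) := by
  set P := Measure.infinitePi μ
  set D : ℝ := 8 * (16 * quantileMomentConst)
  have hD : 0 < D := by
    have := le_quantileMomentConst
    positivity
  obtain ⟨a, ha0, ha⟩ := exists_pos_measureReal_lt_abs_le hf (show 0 < 1 / (8 * D) by positivity)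
  refine integrable_of_forall_integral_min_le hf (M := 2 + 2 * (a + 1) ^ 2) fun N hN => ?_
  have hN1 : (1 : ℝ) ≤ N := by exact_mod_cast hN
  have hN0 : (0 : ℝ) < N := by linarith
  -- The tolerance `1 / (8D)` transfers the quantile from `f` to `U`; `1 / N` pays for the factor
  -- `N` on the set where `U` is far from `f`. The approximant depends on `N`, but the final bound
  -- does not.
  obtain ⟨n, b, hnb⟩ := exists_headFunctional_approx hf
    (show 0 < min (1 / (8 * D)) (1 / (N : ℝ)) by positivity)
  set U : RInfty m → ℝ := fun x => headFunctional f n x + b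
  have hU : MemLp U 4 P := (memLp_four_headFunctional hconv f n).add (memLp_const b)
  have hfU : AEMeasurable (fun x => f x - U x) P := hf.sub hU.aestronglyMeasurable.aemeasurable
  have hmin := integrable_min_abs_one hfU
  have hfar : P.real {x | 1 ≤ min |f x - U x| 1} ≤ 1 / (8 * D) := by
    have h := mul_meas_ge_le_integral_of_nonneg (μ := P)
      (ae_of_all _ fun x => le_min (abs_nonneg _) zero_le_one) hmin 1
    rw [one_mul] at h
    exact h.trans (hnb.trans (min_le_left _ _))
  have htail : P.real {x | a + 1 < |U x|} ≤ 1 / (4 * D) := by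
    have hsub : {x | a + 1 < |U x|} ⊆ {x | a < |f x|} ∪ {x | 1 ≤ min |f x - U x| 1} := by
      intro x hx
      by_contra hcon
      simp only [Set.mem_union, Set.mem_ofPred_eq, not_or, not_lt, le_min_iff, le_refl, and_true,
        not_le] at hx hcon
      have h := abs_sub (f x) (f x - U x)
      rw [sub_sub_cancel] at h
      linarith [hcon.1, hcon.2]
    calc P.real {x | a + 1 < |U x|} ≤ _ := measureReal_mono hsub
      _ ≤ 1 / (8 * D) + 1 / (8 * D) := (measureReal_union_le _ _).trans (add_le_add ha hfar)
      _ = 1 / (4 * D) := by field_simp; norm_num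
  have hsq := second_moment_le_of_quantile hD hU
    (fourth_moment_headFunctional_add_const_le hconv f n b) htail
  have hpt : ∀ x, min |f x| (N : ℝ) ≤ (1 + U x ^ 2) + N * min |f x - U x| 1 := by
    intro x
    have hUx : |U x| ≤ 1 + U x ^ 2 := by
      rw [← sq_abs]; nlinarith [sq_nonneg (|U x| - 1), abs_nonneg (U x)]
    rcases le_total |f x - U x| 1 with h1 | h1
    · rw [min_eq_left h1]
      have h := abs_add_le (f x - U x) (U x)
      rw [sub_add_cancel] at h
      nlinarith [min_le_left |f x| (N : ℝ), abs_nonneg (f x - U x)]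
    · rw [min_eq_right h1]
      nlinarith [min_le_right |f x| (N : ℝ), sq_nonneg (U x)]
  have hU2 := hU.integrable_pow_of_le_four (k := 2) (by norm_num)
  have i₁ : Integrable (fun x => 1 + U x ^ 2) P := (integrable_const 1).add hU2
  have hle : ∫ x, min |f x| (N : ℝ) ∂P ≤ ∫ x, ((1 + U x ^ 2) + N * min |f x - U x| 1) ∂P := by
    refine integral_mono_of_nonneg (ae_of_all _ fun x => le_min (abs_nonneg _) hN0.le)
      (i₁.add (hmin.const_mul _)) (ae_of_all _ hpt)
  rw [integral_add i₁ (hmin.const_mul _), integral_add (integrable_const _) hU2,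
    integral_const_mul] at hle
  have hlast : (N : ℝ) * ∫ x, min |f x - U x| 1 ∂P ≤ 1 := by
    calc (N : ℝ) * ∫ x, min |f x - U x| 1 ∂P ≤ N * (1 / N) :=
          mul_le_mul_of_nonneg_left (hnb.trans (min_le_right _ _)) hN0.le
      _ = 1 := by field_simp
  simp only [integral_const, probReal_univ, one_smul] at hle
  linarith

end LinearFunctional

/-! ### The approximating functionals and their affine corrections -/

theorem mainTheorem1 (m : ℕ → ℕ)
    (μ : (k : ℕ) → Measure (EuclideanSpace ℝ (Fin (m k))))
    [∀ k, IsProbabilityMeasure (μ k)]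
    (hconv : ∀ k, IsConvexMeasure (μ k))
    (q : ℕ) (hq : 0 ∉ affineSpan ℝ (μ q).support)
    (f : RInfty m →ₗ[ℝ] ℝ) (hf : AEMeasurable f (Measure.infinitePi μ)) :
    Integrable f (Measure.infinitePi μ) ∧
    ∃ (g : ℕ → RInfty m →L[ℝ] ℝ) (φ : ℕ → RInfty m →ᴬ[ℝ] ℝ),
      (∀ n, q < n →
        -- the conditional expectation given the first `n` factors, as a function defined everywhere
        (∀ x, Integrable (fun y => f (splice n x y)) (Measure.infinitePi μ)) ∧
        (tailAverage (Measure.infinitePi μ) f n =ᵐ[Measure.infinitePi μ]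
          (Measure.infinitePi μ)[f | cylinderEvents (Set.Iio n)]) ∧
        -- the affine correction
        DependsOn (φ n) (Set.Iio n) ∧
        (∀ x : RInfty m, (∀ k, k < n → x k ∈ (μ k).support) → φ n x = 0) ∧
        -- the approximating finite-dimensional continuous linear functional
        DependsOn (g n) (Set.Iio n) ∧
        (∀ x, g n x = tailAverage (Measure.infinitePi μ) f n x + φ n x)) ∧
      ∀ᵐ x ∂(Measure.infinitePi μ), Tendsto (fun n => g n x) atTop (𝓝 (f x)) := by
  have hint := integrable_linear_of_isConvexMeasure hconv hf
  refine ⟨hint, ?_⟩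
  set P := Measure.infinitePi μ
  obtain ⟨l₀, hl₀⟩ := exists_dual_eq_one_of_zero_notMem_affineSpan hq
  set l : RInfty m →L[ℝ] ℝ := l₀.toContinuousLinearMap.comp (ContinuousLinearMap.proj q)
  have hl : ∀ x, l x = l₀ (x q) := fun x => rfl
  have htail : ∀ n, Integrable (fun y => f y - headFunctional f n y) P := fun n =>
    hint.sub ((memLp_four_headFunctional hconv f n).integrable (by norm_num))
  set c : ℕ → ℝ := fun n => ∫ y, (f y - headFunctional f n y) ∂P
  have havg : ∀ n x, tailAverage P f n x = headFunctional f n x + c n := fun n x => by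
    simp only [tailAverage, map_splice]
    rw [integral_add (integrable_const _) (htail n)]
    simp [c]
  have hg : ∀ n x, (headFunctional f n + c n • l) x =
      tailAverage P f n x + c n * (l₀ (x q) - 1) := fun n x => by
    rw [havg, add_apply, smul_apply, hl, smul_eq_mul]
    ring
  -- Since `l` reads only the factor `q`, dependence on the first `n` factors needs `q < n`.
  refine ⟨fun n => headFunctional f n + c n • l,
    fun n => c n • (l.toContinuousAffineMap - ContinuousAffineMap.const ℝ (RInfty m) 1),
    fun n hn => ⟨fun x => ?_, tailAverage_ae_eq_condExp μ hint n, fun x y h => ?_, fun x hx => ?_,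
      fun x y h => ?_, fun x => ?_⟩, ?_⟩
  · simp only [map_splice]
    exact (integrable_const _).add (htail n)
  · change c n * (l₀ (x q) - 1) = c n * (l₀ (y q) - 1)
    rw [h q hn]
  · change c n * (l₀ (x q) - 1) = 0
    rw [hl₀ _ (hx q hn), sub_self, mul_zero]
  · change headFunctional f n x + c n * l₀ (x q) = headFunctional f n y + c n * l₀ (y q)
    rw [dependsOn_headFunctional f n h, h q hn]
  · exact hg n x
  -- The support of `μ q` has full measure, so the corrections vanish almost everywhere and the
  -- limit is that of the tail averages.
  · have hsupp : ∀ᵐ x ∂P, x q ∈ (μ q).support :=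
      (measurePreserving_eval_infinitePi μ q).quasiMeasurePreserving.ae Measure.support_mem_ae
    filter_upwards [ae_tendsto_tailAverage μ hint, hsupp] with x hx hxq
    refine hx.congr fun n => ?_
    rw [hg, hl₀ _ hxq, sub_self, mul_zero, add_zero]
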